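/- Let $M$ be a pointed metric space with metric $d$ and base point $0$. Let $\mathrm{Lip}_0(M)$ be the space of all Lipschitz functions $f\colon M\to\mathbb R$ with $f(0)=0$, with the norm $\|f\|=\sup_{x\neq y}|f(x)-f(y)|/d(x,y)$. Put $\widetilde M=\{(x,y)\in M\times M: x\ne y\}$ and, for $A\subseteq M$, $\Gamma_A=\{(x,y)\in\widetilde M: x\in A\text{ or }y\in A\}$. * $M$ has the function SLTP (FSLTP) if for every bounded finitely additive measure $\mu\ge 0$ on the power set of $\widetilde M$, every $\varepsilon\in(0,1)$, and all finite families $f_1,\dots,f_n\in\mathrm{Lip}_0(M)$ with $\|f_i\|\le 1$, there are $A\subseteq M$ with $\mu(\Gamma_A)<\varepsilon$ and $u,v\in A$, $u\ne v$, such that $$(1-\varepsilon)\bigl(f_i(x)-f_i(y)+d(u,v)\bigr)\le d(x,u)+d(y,v),$$ $$(1-\varepsilon)\bigl(f_i(x)-f_i(y)+f_j(z)-f_j(w)+2d(u,v)\bigr)\le d(x,u)+d(y,u)+d(z,v)+d(w,v)$$ for all $x,y,z,w\in M\setminus A$ and all $i,j\in\{1,\dots,n\}$. * $M$ has the seq-SLTP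 if for every $\varepsilon>0$ there are pairwise disjoint sets $A_1,A_2,\dots\subseteq M$ and points $u_m,v_m\in A_m$, $u_m\ne v_m$, such that for all $m$ and all $x,y,z,w\in M\setminus A_m$ $$(1-\varepsilon)\bigl(d(x,y)+d(u_m,v_m)\bigr)\le d(x,u_m)+d(y,v_m),$$ $$(1-\varepsilon)\bigl(2d(u_m,v_m)+d(x,y)+d(z,w)\bigr)\le d(x,u_m)+d(y,u_m)+d(z,v_m)+d(w,v_m).$$ * A real normed space $X$ with closed unit ball $B_X$ has the symmetric strong diameter 2 property (SSD2P) if for every finite family of slices $S_1,\dots,S_n$ of $B_X$ (sets $\{x\in B_X: x^*(x)>1-\alpha\}$ with $x^*\in X^*$, $\|x^*\|=1$, $\alpha>0$) and every $\varepsilon>0$ there are $f_i\in S_i$ and $g\in B_X$ with $\|g\|>1-\varepsilon$ and $f_i\pm g\in S_i$ for all $i$. Theorem. (1) If $M$ has the FSLTP, then $\mathrm{Lip}_0(M)$ has the SSD2P. (2) The FSLTP is strictly weaker than the seq-SLTP: every pointed metric space with the seq-SLTP has the FSLTP, and there is a pointed metric space that has the FSLTP but not the seq-SLTP. -/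

import Mathlib

open MeasureTheory

universe u

section LipschitzSpace

variable {M : Type u} [MetricSpace M]

variable (M) in
/-- The set of pairs `(x, y)` of distinct points of `M`. -/
abbrev OffDiagPair : Type u := {p : M × M // p.1 ≠ p.2}

/-- The set of those pairs of distinct points that have at least one coordinate in `A`. -/
def gammaSet (A : Set M) : Set (OffDiagPair M) := {p | p.1.1 ∈ A ∨ p.1.2 ∈ A}

/-- The real vector space of the Lipschitz functions on `M` that vanish at the base point `o`. -/
def lipZeroSubmodule (o : M) : Submodule ℝ (M → ℝ) where
  carrier := {f | (∃ K : NNReal, LipschitzWith K f) ∧ f o = 0}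
  add_mem' := by
    rintro f g ⟨⟨K, hf⟩, hf0⟩ ⟨⟨L, hg⟩, hg0⟩
    exact ⟨⟨K + L, hf.add hg⟩, by simp [hf0, hg0]⟩
  zero_mem' := ⟨⟨0, LipschitzWith.const 0⟩, rfl⟩
  smul_mem' := by
    rintro c f ⟨⟨K, hf⟩, hf0⟩
    refine ⟨⟨‖c‖₊ * K, (lipschitzWith_smul c).comp hf⟩, by simp [hf0]⟩

/-- The space `Lip₀(M)` of the pointed metric space `(M, o)`. -/
def LipZero (o : M) : Type u := lipZeroSubmodule o

namespace LipZero

variable {o : M}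

noncomputable instance : AddCommGroup (LipZero o) :=
  inferInstanceAs (AddCommGroup (lipZeroSubmodule o))

noncomputable instance : Module ℝ (LipZero o) :=
  inferInstanceAs (Module ℝ (lipZeroSubmodule o))

instance : FunLike (LipZero o) M ℝ where
  coe f := f.1
  coe_injective _ _ h := Subtype.ext h

@[ext] theorem ext {f g : LipZero o} (h : ∀ x, f x = g x) : f = g := DFunLike.ext _ _ h

@[simp] theorem zero_apply (x : M) : (0 : LipZero o) x = 0 := rfl

@[simp] theorem add_apply (f g : LipZero o) (x : M) : (f + g) x = f x + g x := rfl

@[simp] theorem smul_apply (c : ℝ) (f : LipZero o) (x : M) : (c • f) x = c * f x := rfl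

@[simp] theorem map_base (f : LipZero o) : f o = 0 := f.2.2

/-- The Lipschitz constant: the supremum of `|f x - f y| / d(x, y)` over `x ≠ y`. -/
noncomputable instance : Norm (LipZero o) where
  norm f := ⨆ p : OffDiagPair M, |f p.1.1 - f p.1.2| / dist p.1.1 p.1.2

theorem norm_def (f : LipZero o) :
    ‖f‖ = ⨆ p : OffDiagPair M, |f p.1.1 - f p.1.2| / dist p.1.1 p.1.2 := rfl

theorem bddAbove_quotients (f : LipZero o) :
    BddAbove (Set.range fun p : OffDiagPair M => |f p.1.1 - f p.1.2| / dist p.1.1 p.1.2) := by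
  obtain ⟨K, hK⟩ := f.2.1
  refine ⟨K, ?_⟩
  rintro _ ⟨p, rfl⟩
  have hp : 0 < dist p.1.1 p.1.2 := dist_pos.2 p.2
  have h := hK.dist_le_mul p.1.1 p.1.2
  rw [Real.dist_eq] at h
  exact (div_le_iff₀ hp).2 h

theorem abs_sub_le_norm_mul (f : LipZero o) (x y : M) : |f x - f y| ≤ ‖f‖ * dist x y := by
  by_cases h : x = y
  · simp [h]
  · have hp : 0 < dist x y := dist_pos.2 h
    exact (div_le_iff₀ hp).1 (le_ciSup (bddAbove_quotients f) (⟨(x, y), h⟩ : OffDiagPair M))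

theorem norm_le_of_forall (f : LipZero o) {C : ℝ} (hC : 0 ≤ C)
    (h : ∀ x y, |f x - f y| ≤ C * dist x y) : ‖f‖ ≤ C := by
  refine Real.iSup_le (fun p => ?_) hC
  exact (div_le_iff₀ (dist_pos.2 p.2)).2 (h _ _)

theorem norm_core : NormedSpace.Core ℝ (LipZero o) where
  norm_nonneg f := Real.iSup_nonneg fun p => by positivity
  norm_smul c f := by
    rw [norm_def, norm_def, Real.norm_eq_abs, Real.mul_iSup_of_nonneg (abs_nonneg c)]
    refine iSup_congr fun p => ?_
    rw [smul_apply, smul_apply, ← mul_sub, abs_mul, mul_div_assoc]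
  norm_triangle f g := by
    have hf : 0 ≤ ‖f‖ := Real.iSup_nonneg fun p => by positivity
    have hg : 0 ≤ ‖g‖ := Real.iSup_nonneg fun p => by positivity
    refine norm_le_of_forall _ (add_nonneg hf hg) fun x y => ?_
    have h : (f + g) x - (f + g) y = (f x - f y) + (g x - g y) := by
      simp only [add_apply]; ring
    rw [h, add_mul]
    exact (abs_add_le _ _).trans
      (add_le_add (abs_sub_le_norm_mul f x y) (abs_sub_le_norm_mul g x y))
  norm_eq_zero_iff f := by
    constructor
    · intro h
      ext x
      have := abs_sub_le_norm_mul f x o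
      rw [h, zero_mul, map_base, sub_zero] at this
      simpa using abs_nonpos_iff.1 this
    · rintro rfl
      simp [norm_def]

noncomputable instance : NormedAddCommGroup (LipZero o) := NormedAddCommGroup.ofCore norm_core

noncomputable instance : NormedSpace ℝ (LipZero o) := NormedSpace.ofCore norm_core

end LipZero

end LipschitzSpace

section DiameterTwo

variable {X : Type u} [NormedAddCommGroup X] [NormedSpace ℝ X]

/-- Slices of the closed unit ball of `X`: sets `{x ∈ B_X : φ x > 1 - α}` with `φ` a norm-one
functional and `α > 0`. -/
def IsSlice (S : Set X) : Prop :=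
  ∃ φ : StrongDual ℝ X, ‖φ‖ = 1 ∧ ∃ α : ℝ, 0 < α ∧ S = {x | ‖x‖ ≤ 1 ∧ 1 - α < φ x}

variable (X) in
/-- The symmetric strong diameter two property. -/
def SSD2P : Prop :=
  ∀ (n : ℕ) (S : Fin n → Set X), (∀ i, IsSlice (S i)) → ∀ ε : ℝ, 0 < ε →
    ∃ (f : Fin n → X) (g : X), (∀ i, f i ∈ S i) ∧ ‖g‖ ≤ 1 ∧ 1 - ε < ‖g‖ ∧
      ∀ i, f i + g ∈ S i ∧ f i - g ∈ S i

end DiameterTwo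

/-- The bounded finitely additive signed measures on the power set of `E`. -/
def ba (E : Type u) : Set (AddContent ℝ (Set.univ : Set (Set E))) :=
  {μ | ∃ C : ℝ, ∀ S : Set E, |μ S| ≤ C}

/-- The function SLTP of the pointed metric space `(M, o)`. -/
def FSLTP {M : Type u} [MetricSpace M] (o : M) : Prop :=
  ∀ μ ∈ ba (OffDiagPair M), (∀ S, 0 ≤ μ S) → ∀ ε : ℝ, 0 < ε → ε < 1 →
    ∀ (n : ℕ) (f : Fin n → LipZero o), (∀ i, ‖f i‖ ≤ 1) →
      ∃ (A : Set M) (u v : M), μ (gammaSet A) < ε ∧ u ∈ A ∧ v ∈ A ∧ u ≠ v ∧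
        (∀ x ∉ A, ∀ y ∉ A, ∀ i,
          (1 - ε) * (f i x - f i y + dist u v) ≤ dist x u + dist y v) ∧
        (∀ x ∉ A, ∀ y ∉ A, ∀ z ∉ A, ∀ w ∉ A, ∀ i j,
          (1 - ε) * (f i x - f i y + (f j z - f j w) + 2 * dist u v) ≤
            dist x u + dist y u + dist z v + dist w v)

/-- The sequential SLTP of the metric space `M`. -/
def SeqSLTP (M : Type u) [MetricSpace M] : Prop :=
  ∀ ε : ℝ, 0 < ε →
    ∃ (A : ℕ → Set M) (u v : ℕ → M), (∀ k l, k ≠ l → Disjoint (A k) (A l)) ∧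
      ∀ m, u m ∈ A m ∧ v m ∈ A m ∧ u m ≠ v m ∧
        (∀ x ∉ A m, ∀ y ∉ A m,
          (1 - ε) * (dist x y + dist (u m) (v m)) ≤ dist x (u m) + dist y (v m)) ∧
        (∀ x ∉ A m, ∀ y ∉ A m, ∀ z ∉ A m, ∀ w ∉ A m,
          (1 - ε) * (2 * dist (u m) (v m) + dist x y + dist z w) ≤
            dist x (u m) + dist y (u m) + dist z (v m) + dist w (v m))

/-!
The de Leeuw map `f ↦ (f x - f y) / d(x, y)` embeds `Lip₀(M)` isometrically into the bounded
functions on the pairs of distinct points, so by Hahn–Banach a functional on `Lip₀(M)` extends to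
`ℓ^∞`, and its variation is a positive bounded finitely additive measure `μ`. On a function of norm
at most `1` that is constant off `A`, the functional is at most `μ(Γ_A)`: only values off `A`
matter.

Let `f_i` be in the unit ball, scaled by `1 - ε`, and let `A`, `u`, `v` come from the FSLTP of `M`.
Its inequalities say that certain intervals in `ℝ` meet pairwise, and thus give radii `r`, `s` with
`r + s = (1 - ε) d(u, v)` and centres `a_i` with `|f_i - a_i| ≤ min (d(·, u) - r) (d(·, v) - s)`
off `A`. Let `g` be the truncation of `0` to `[r - d(·, u), d(·, v) - s]`, so that `g u - g v = r +
s`, and let `h_i` be the truncation of `f_i` around `a_i` with radius the positive part of the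
above minimum. Off `A`, `g = 0` and `h_i = f_i`. The functions `h_i ± g` are again truncations of
`f_i` between `1`-Lipschitz functions, hence `1`-Lipschitz.

Under the seq-SLTP the sets `A_m` are disjoint, so `μ(Γ_{A_m})` tends to `0`. For the strictness
take a graph with the metric in which adjacent vertices have distance `1` and other distinct
vertices distance `2`. If any two vertices have a common neighbour that is not adjacent to two
further given vertices, the sets `A_m` of the seq-SLTP cannot be disjoint. If moreover the vertices
are generated from infinitely many base points, each new vertex being joined to two parents, then
every vertex is a child of at most two base points, so some pair of base points has a neighbourhood
of small measure.
-/

section FinitelyAdditive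

open Filter Function Topology

variable {E : Type*} {μ : AddContent ℝ (Set.univ : Set (Set E))}

theorem addContent_univ_union {S T : Set E} (h : Disjoint S T) : μ (S ∪ T) = μ S + μ T :=
  addContent_union' (Set.mem_univ _) (Set.mem_univ _) (Set.mem_univ _) h

theorem addContent_univ_mono (hμ : ∀ S, 0 ≤ μ S) {S T : Set E} (h : S ⊆ T) : μ S ≤ μ T := by
  rw [← Set.union_sdiff_cancel h, addContent_univ_union Set.disjoint_sdiff_right]
  exact le_add_of_nonneg_right (hμ _)

theorem addContent_univ_union_le (hμ : ∀ S, 0 ≤ μ S) (S T : Set E) :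
    μ (S ∪ T) ≤ μ S + μ T := by
  rw [← Set.union_sdiff_self, addContent_univ_union Set.disjoint_sdiff_right]
  exact add_le_add_right (addContent_univ_mono hμ Set.sdiff_subset) _

theorem tendsto_addContent_univ_of_pairwise_disjoint (hμ : ∀ S, 0 ≤ μ S) {S : ℕ → Set E}
    (hS : Pairwise (Disjoint on S)) : Tendsto (fun k => μ (S k)) atTop (𝓝 0) := by
  refine (summable_of_sum_range_le (c := μ Set.univ) (fun k => hμ _) fun n => ?_).tendsto_atTop_zero
  rw [← addContent_biUnion (fun _ _ => Set.mem_univ _) (hS.set_pairwise _) (Set.mem_univ _)]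
  exact addContent_univ_mono hμ (Set.subset_univ _)

theorem gammaSet_union {M : Type*} (A B : Set M) :
    gammaSet (A ∪ B) = gammaSet A ∪ gammaSet B :=
  Set.ext fun _ => or_or_or_comm

variable {M : Type*} {μ : AddContent ℝ (Set.univ : Set (Set (OffDiagPair M)))}

theorem tendsto_addContent_gammaSet_of_pairwise_disjoint (hμ : ∀ S, 0 ≤ μ S) {A : ℕ → Set M}
    (hA : Pairwise (Disjoint on A)) : Tendsto (fun k => μ (gammaSet (A k))) atTop (𝓝 0) := by
  have hfst := tendsto_addContent_univ_of_pairwise_disjoint hμ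
    (S := fun k => (fun p : OffDiagPair M => p.1.1) ⁻¹' A k) fun _ _ h => (hA h).preimage _
  have hsnd := tendsto_addContent_univ_of_pairwise_disjoint hμ
    (S := fun k => (fun p : OffDiagPair M => p.1.2) ⁻¹' A k) fun _ _ h => (hA h).preimage _
  have hsum := hfst.add hsnd
  rw [add_zero] at hsum
  exact squeeze_zero (fun _ => hμ _) (fun _ => addContent_univ_union_le hμ _ _) hsum

theorem tendsto_addContent_gammaSet_union (hμ : ∀ S, 0 ≤ μ S) {A B : ℕ → Set M}
    (hA : Pairwise (Disjoint on A)) (hB : Pairwise (Disjoint on B)) :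
    Tendsto (fun k => μ (gammaSet (A k ∪ B k))) atTop (𝓝 0) := by
  have hsum := (tendsto_addContent_gammaSet_of_pairwise_disjoint hμ hA).add
    (tendsto_addContent_gammaSet_of_pairwise_disjoint hμ hB)
  rw [add_zero] at hsum
  simp only [gammaSet_union]
  exact squeeze_zero (fun _ => hμ _) (fun _ => addContent_univ_union_le hμ _ _) hsum

end FinitelyAdditive

namespace LipZero

variable {M : Type*} [MetricSpace M] {o : M}

theorem neg_apply (f : LipZero o) (x : M) : (-f) x = -f x := rfl

theorem sub_apply (f g : LipZero o) (x : M) : (f - g) x = f x - g x := rfl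

theorem lipschitzWith_one {f : LipZero o} (hf : ‖f‖ ≤ 1) : LipschitzWith 1 f :=
  .mk_one fun x y => (f.abs_sub_le_norm_mul x y).trans (mul_le_of_le_one_left dist_nonneg hf)

theorem sub_le_dist {f : LipZero o} (hf : ‖f‖ ≤ 1) (x y : M) : f x - f y ≤ dist x y :=
  (le_abs_self _).trans ((lipschitzWith_one hf).dist_le_mul x y |>.trans_eq (one_mul _))

/-- The translate `G - G o` of a Lipschitz function `G`, as an element of `Lip₀(M)`. -/
def ofLipschitzWith (o : M) {K : NNReal} {G : M → ℝ} (hG : LipschitzWith K G) : LipZero o :=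
  ⟨fun x => G x - G o, ⟨K, by simpa using hG.sub (.const (G o))⟩, sub_self _⟩

theorem ofLipschitzWith_apply {K : NNReal} {G : M → ℝ} (hG : LipschitzWith K G) (x : M) :
    ofLipschitzWith o hG x = G x - G o := rfl

theorem norm_le_of_lipschitzWith {f : LipZero o} {K : NNReal} {G : M → ℝ} (hG : LipschitzWith K G)
    (h : ∀ x y, f x - f y = G x - G y) : ‖f‖ ≤ K :=
  f.norm_le_of_forall K.2 fun x y => by rw [h]; exact hG.dist_le_mul x y

end LipZero

theorem SeqSLTP.fsltp {M : Type*} [MetricSpace M] (hM : SeqSLTP M) (o : M) : FSLTP o := by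
  intro μ _ hμ ε hε hε1 n f hf
  obtain ⟨A, u, v, hdisj, hA⟩ := hM ε hε
  obtain ⟨m, hm⟩ := ((tendsto_addContent_gammaSet_of_pairwise_disjoint hμ
    fun k l => hdisj k l).eventually_lt_const hε).exists
  obtain ⟨hu, hv, huv, htwo, hfour⟩ := hA m
  refine ⟨A m, u m, v m, hm, hu, hv, huv, fun x hx y hy i => ?_, fun x hx y hy z hz w hw i j => ?_⟩
  · refine le_trans (mul_le_mul_of_nonneg_left ?_ (by linarith)) (htwo x hx y hy)
    linarith [LipZero.sub_le_dist (hf i) x y]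
  · refine le_trans (mul_le_mul_of_nonneg_left ?_ (by linarith)) (hfour x hx y hy z hz w hw)
    linarith [LipZero.sub_le_dist (hf i) x y, LipZero.sub_le_dist (hf j) z w]

section Variation

open scoped ENNReal lp

variable {ι : Type*}

/-- The variation on `S` of a functional `Φ` on the bounded functions: the supremum of `Φ k` over
the functions `k` in the unit ball that vanish off `S`. -/
noncomputable def variation (Φ : StrongDual ℝ ℓ^∞(ι, ℝ)) (S : Set ι) : ℝ :=
  sSup (Φ '' {k | ‖k‖ ≤ 1 ∧ ∀ i ∉ S, k i = 0})

variable {Φ : StrongDual ℝ ℓ^∞(ι, ℝ)} {S T : Set ι}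

theorem apply_le_opNorm_of_norm_le_one {X : Type*} [NormedAddCommGroup X] [NormedSpace ℝ X]
    (φ : StrongDual ℝ X) {f : X} (hf : ‖f‖ ≤ 1) : φ f ≤ ‖φ‖ :=
  (le_abs_self _).trans ((φ.le_opNorm f).trans (mul_le_of_le_one_right (norm_nonneg _) hf))

theorem le_variation {k : ℓ^∞(ι, ℝ)} (hk : ‖k‖ ≤ 1) (hS : ∀ i ∉ S, k i = 0) :
    Φ k ≤ variation Φ S := by
  refine le_csSup ⟨‖Φ‖, ?_⟩ (Set.mem_image_of_mem Φ ⟨hk, hS⟩)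
  rintro _ ⟨l, hl, rfl⟩
  exact apply_le_opNorm_of_norm_le_one Φ hl.1

theorem variation_le {C : ℝ} (h : ∀ k, ‖k‖ ≤ 1 → (∀ i ∉ S, k i = 0) → Φ k ≤ C) :
    variation Φ S ≤ C := by
  refine csSup_le (Set.Nonempty.image Φ ⟨0, by simp⟩) ?_
  rintro _ ⟨k, hk, rfl⟩
  exact h k hk.1 hk.2

theorem variation_nonneg (Φ : StrongDual ℝ ℓ^∞(ι, ℝ)) (S : Set ι) : 0 ≤ variation Φ S :=
  (map_zero Φ).symm.trans_le (le_variation (by simp) fun _ _ => rfl)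

theorem variation_le_opNorm (Φ : StrongDual ℝ ℓ^∞(ι, ℝ)) (S : Set ι) : variation Φ S ≤ ‖Φ‖ :=
  variation_le fun _ hk _ => apply_le_opNorm_of_norm_le_one Φ hk

theorem variation_empty (Φ : StrongDual ℝ ℓ^∞(ι, ℝ)) : variation Φ ∅ = 0 := by
  refine le_antisymm (variation_le fun k _ hk => ?_) (variation_nonneg Φ ∅)
  have hk0 : k = 0 := by ext i; exact hk i (Set.notMem_empty i)
  rw [hk0, map_zero]

theorem exists_lp_eq_indicator (k : ℓ^∞(ι, ℝ)) (S : Set ι) :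
    ∃ l : ℓ^∞(ι, ℝ), ‖l‖ ≤ ‖k‖ ∧ ⇑l = S.indicator k := by
  have hle : ∀ i, ‖S.indicator k i‖ ≤ ‖k‖ := fun i =>
    (norm_indicator_le_norm_self _ i).trans (lp.norm_apply_le_norm ENNReal.top_ne_zero k i)
  exact ⟨⟨S.indicator k, memℓp_infty ⟨‖k‖, Set.forall_mem_range.2 hle⟩⟩,
    lp.norm_le_of_forall_le (norm_nonneg k) hle, rfl⟩

theorem variation_union_le (hST : Disjoint S T) :
    variation Φ (S ∪ T) ≤ variation Φ S + variation Φ T := by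
  refine variation_le fun k hk hk0 => ?_
  obtain ⟨kS, hkS, hS⟩ := exists_lp_eq_indicator k S
  obtain ⟨kT, hkT, hT⟩ := exists_lp_eq_indicator k T
  have hsum : k = kS + kT := by
    ext1
    rw [lp.coeFn_add, hS, hT]
    exact (Set.indicator_eq_self.2 (Function.support_subset_iff'.2 hk0)).symm.trans
      (Set.indicator_union_of_disjoint hST k)
  rw [hsum, map_add]
  exact add_le_add
    (le_variation (hkS.trans hk) fun i hi => hS ▸ Set.indicator_of_notMem hi k)
    (le_variation (hkT.trans hk) fun i hi => hT ▸ Set.indicator_of_notMem hi k)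

theorem variation_add_le (hST : Disjoint S T) :
    variation Φ S + variation Φ T ≤ variation Φ (S ∪ T) := by
  rw [← le_sub_iff_add_le]
  refine variation_le fun k hk hkS => ?_
  rw [le_sub_comm]
  refine variation_le fun l hl hlT => ?_
  rw [le_sub_iff_add_le, ← map_add]
  refine le_variation (lp.norm_le_of_forall_le zero_le_one fun i => ?_) fun i hi => ?_
  · rw [lp.coeFn_add, Pi.add_apply]
    by_cases hi : i ∈ S
    · rw [hlT i (Set.disjoint_left.1 hST hi), zero_add]
      exact (lp.norm_apply_le_norm ENNReal.top_ne_zero k i).trans hk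
    · rw [hkS i hi, add_zero]
      exact (lp.norm_apply_le_norm ENNReal.top_ne_zero l i).trans hl
  · rw [Set.mem_union, not_or] at hi
    rw [lp.coeFn_add, Pi.add_apply, hkS i hi.1, hlT i hi.2, add_zero]

theorem abs_apply_le_norm_mul_variation (Φ : StrongDual ℝ ℓ^∞(ι, ℝ)) {k : ℓ^∞(ι, ℝ)}
    (hk : ∀ i ∉ S, k i = 0) : |Φ k| ≤ ‖k‖ * variation Φ S := by
  have hle : ∀ l : ℓ^∞(ι, ℝ), (∀ i ∉ S, l i = 0) → Φ l ≤ ‖l‖ * variation Φ S := by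
    intro l hl
    rcases eq_or_ne l 0 with rfl | hl0
    · simp
    have hnorm : ‖‖l‖⁻¹ • l‖ ≤ 1 := (norm_smul_inv_norm (𝕜 := ℝ) hl0).le
    have := le_variation (Φ := Φ) hnorm fun i hi => by
      rw [lp.coeFn_smul, Pi.smul_apply, hl i hi, smul_zero]
    rwa [map_smul, smul_eq_mul, inv_mul_le_iff₀ (norm_pos_iff.2 hl0)] at this
  refine abs_le'.2 ⟨hle k hk, ?_⟩
  rw [← map_neg, ← norm_neg k]
  exact hle (-k) fun i hi => by rw [lp.coeFn_neg, Pi.neg_apply, hk i hi, neg_zero]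

theorem isSetRing_univ : IsSetRing (Set.univ : Set (Set ι)) :=
  ⟨Set.mem_univ _, fun _ _ _ _ => Set.mem_univ _, fun _ _ _ _ => Set.mem_univ _⟩

theorem exists_mem_ba_forall_abs_apply_le {κ : Type*} [Finite κ]
    (Φ : κ → StrongDual ℝ ℓ^∞(ι, ℝ)) :
    ∃ μ ∈ ba ι, (∀ S, 0 ≤ μ S) ∧
      ∀ j S k, (∀ i ∉ S, k i = 0) → |Φ j k| ≤ ‖k‖ * μ S := by
  obtain ⟨_⟩ := nonempty_fintype κ
  have hnonneg : ∀ S, 0 ≤ ∑ j, variation (Φ j) S := fun S =>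
    Finset.sum_nonneg fun j _ => variation_nonneg (Φ j) S
  refine ⟨isSetRing_univ.addContent_of_union (fun S => ∑ j, variation (Φ j) S)
    (by simp only [variation_empty, Finset.sum_const_zero]) fun _ _ hST => ?_,
    ⟨∑ j, ‖Φ j‖, fun S => ?_⟩, hnonneg, fun j S k hk => ?_⟩
  · rw [← Finset.sum_add_distrib]
    exact Finset.sum_congr rfl fun j _ =>
      (variation_union_le hST).antisymm (variation_add_le hST)
  · exact (abs_of_nonneg (hnonneg S)).trans_le
      (Finset.sum_le_sum fun j _ => variation_le_opNorm (Φ j) S)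
  · refine (abs_apply_le_norm_mul_variation (Φ j) hk).trans
      (mul_le_mul_of_nonneg_left ?_ (norm_nonneg k))
    exact Finset.single_le_sum (f := fun j => variation (Φ j) S)
      (fun j _ => variation_nonneg (Φ j) S) (Finset.mem_univ j)

end Variation

namespace LipZero

open scoped ENNReal lp

variable {M : Type*} [MetricSpace M] (o : M)

/-- The de Leeuw embedding of `Lip₀(M)` into the bounded functions on the pairs of distinct
points, sending `f` to its difference quotients. -/
noncomputable def deLeeuw : LipZero o →ₗᵢ[ℝ] ℓ^∞(OffDiagPair M, ℝ) where
  toFun f := ⟨fun p => (f p.1.1 - f p.1.2) / dist p.1.1 p.1.2, memℓp_infty <| by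
    simpa only [Real.norm_eq_abs, abs_div, abs_dist] using f.bddAbove_quotients⟩
  map_add' f g := by
    ext p
    simp only [add_apply, lp.coeFn_add, Pi.add_apply]
    ring
  map_smul' c f := by
    ext p
    simp only [smul_apply, lp.coeFn_smul, Pi.smul_apply, smul_eq_mul, RingHom.id_apply]
    ring
  norm_map' f := by
    simp only [lp.norm_eq_ciSup, norm_def, LinearMap.coe_mk, AddHom.coe_mk, Real.norm_eq_abs,
      abs_div, abs_dist]

variable {o}

theorem deLeeuw_apply (f : LipZero o) (p : OffDiagPair M) :
    deLeeuw o f p = (f p.1.1 - f p.1.2) / dist p.1.1 p.1.2 := rfl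

theorem exists_comp_deLeeuw_eq (φ : StrongDual ℝ (LipZero o)) :
    ∃ Φ : StrongDual ℝ ℓ^∞(OffDiagPair M, ℝ), ∀ f, Φ (deLeeuw o f) = φ f := by
  obtain ⟨Φ, hΦ, -⟩ := exists_extension_norm_eq (𝕜 := ℝ) (deLeeuw o).range
    (φ ∘L ((deLeeuw o).equivRange.symm.toContinuousLinearEquiv : _ →L[ℝ] LipZero o))
  exact ⟨Φ, fun f => by simpa using hΦ ((deLeeuw o).equivRange f)⟩

theorem exists_mem_ba_forall_abs_apply_le_gammaSet {κ : Type*} [Finite κ]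
    (φ : κ → StrongDual ℝ (LipZero o)) :
    ∃ μ ∈ ba (OffDiagPair M), (∀ S, 0 ≤ μ S) ∧ ∀ j (A : Set M) (f : LipZero o),
      (∀ x ∉ A, ∀ y ∉ A, f x = f y) → |φ j f| ≤ ‖f‖ * μ (gammaSet A) := by
  choose Φ hΦ using fun j => exists_comp_deLeeuw_eq (φ j)
  obtain ⟨μ, hμ, hμ0, hΦμ⟩ := exists_mem_ba_forall_abs_apply_le Φ
  refine ⟨μ, hμ, hμ0, fun j A f hf => ?_⟩
  rw [← hΦ, ← (deLeeuw o).norm_map]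
  refine hΦμ j _ _ fun p hp => ?_
  obtain ⟨hp₁, hp₂⟩ := not_or.1 hp
  rw [deLeeuw_apply, hf _ hp₁ _ hp₂, sub_self, zero_div]

end LipZero

section Truncation

/-- The truncation of `t` to the interval `[l, u]`; it is `l` when `u < l`. -/
def truncate (l u t : ℝ) : ℝ := max l (min t u)

theorem truncate_self (l t : ℝ) : truncate l l t = l := max_eq_left (min_le_right t l)

/-- The truncation of `0` to `[-p, q]`, vanishing when `p` and `q` are nonnegative. -/
def bump (p q : ℝ) : ℝ := truncate (-p) q 0

/-- The truncation of `t` to the interval with centre `a` and radius `min p q`, where negative radii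
count as `0`. -/
def plateau (a p q t : ℝ) : ℝ := truncate (a - max 0 (min p q)) (a + max 0 (min p q)) t

theorem bump_eq_zero {p q : ℝ} (hp : 0 ≤ p) (hq : 0 ≤ q) : bump p q = 0 := by
  rw [bump, truncate, min_eq_left hq, max_eq_right (neg_nonpos.2 hp)]

theorem bump_comm {p q : ℝ} (h : 0 ≤ p + q) : bump q p = -bump p q := by
  unfold bump truncate
  grind

theorem plateau_comm (a p q t : ℝ) : plateau a q p t = plateau a p q t := by
  rw [plateau, plateau, min_comm]

theorem plateau_eq_self {a p q t : ℝ} (hp : |t - a| ≤ p) (hq : |t - a| ≤ q) :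
    plateau a p q t = t := by
  obtain ⟨hl, hu⟩ := abs_le.1 ((le_min hp hq).trans (le_max_right 0 _))
  rw [plateau, truncate, min_eq_left (sub_le_iff_le_add'.1 hu),
    max_eq_right (by linarith : a - max 0 (min p q) ≤ t)]

theorem plateau_add_bump (a t : ℝ) {p q : ℝ} (h : 0 ≤ p + q) :
    plateau a p q t + bump p q = truncate (a - min p |q|) (a + min |p| q) t := by
  rcases le_total 0 q with hq | hq
  · rcases le_total 0 p with hp | hp
    · rw [bump_eq_zero hp hq, add_zero, abs_of_nonneg hp, abs_of_nonneg hq, plateau,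
        max_eq_right (le_min hp hq)]
    · have hbump : bump p q = -p := by
        rw [bump, truncate, min_eq_left hq, max_eq_left (neg_nonneg.2 hp)]
      rw [hbump, plateau, max_eq_left (min_le_of_left_le hp), sub_zero, add_zero, truncate_self,
        abs_of_nonneg hq, abs_of_nonpos hp, min_eq_left (hp.trans hq), min_eq_left (by linarith),
        ← sub_eq_add_neg, truncate_self]
  · have hp : 0 ≤ p := by linarith
    have hbump : bump p q = q := by
      rw [bump, truncate, min_eq_right hq, max_eq_right (by linarith)]
    rw [hbump, plateau, max_eq_left (min_le_of_right_le hq), sub_zero, add_zero, truncate_self,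
      abs_of_nonneg hp, abs_of_nonpos hq, min_eq_right (hq.trans hp), min_eq_right (by linarith),
      sub_neg_eq_add, truncate_self]

theorem plateau_sub_bump (a t : ℝ) {p q : ℝ} (h : 0 ≤ p + q) :
    plateau a p q t - bump p q = truncate (a - min q |p|) (a + min |q| p) t := by
  rw [sub_eq_add_neg, ← bump_comm h, ← plateau_comm, plateau_add_bump a t (by rwa [add_comm])]

variable {X : Type*} [PseudoMetricSpace X] {K : NNReal} {F α β : X → ℝ}

theorem lipschitzWith_truncate (hα : LipschitzWith K α) (hβ : LipschitzWith K β)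
    (hF : LipschitzWith K F) : LipschitzWith K fun x => truncate (α x) (β x) (F x) := by
  simpa only [max_self, truncate] using hα.max (hF.min hβ)

theorem lipschitzWith_bump (hα : LipschitzWith K α) (hβ : LipschitzWith K β) :
    LipschitzWith K fun x => bump (α x) (β x) :=
  lipschitzWith_truncate hα.neg hβ ((LipschitzWith.const 0).weaken K.2)

theorem lipschitzWith_truncate_min_abs (a : ℝ) (hα : LipschitzWith K α) (hβ : LipschitzWith K β)
    (hF : LipschitzWith K F) :
    LipschitzWith K fun x => truncate (a - min (α x) |β x|) (a + min |α x| (β x)) (F x) := by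
  refine lipschitzWith_truncate ?_ ?_ hF
  · simpa only [zero_add, max_self, abs_eq_max_neg, Pi.neg_apply] using
      (LipschitzWith.const a).sub (hα.min (hβ.max hβ.neg))
  · simpa only [zero_add, max_self, abs_eq_max_neg, Pi.neg_apply] using
      (LipschitzWith.const a).add ((hα.max hα.neg).min hβ)

theorem lipschitzWith_plateau_add_bump (a : ℝ) (hα : LipschitzWith K α) (hβ : LipschitzWith K β)
    (hF : LipschitzWith K F) (hαβ : ∀ x, 0 ≤ α x + β x) :
    LipschitzWith K fun x => plateau a (α x) (β x) (F x) + bump (α x) (β x) := by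
  simpa only [plateau_add_bump _ _ (hαβ _)] using lipschitzWith_truncate_min_abs a hα hβ hF

theorem lipschitzWith_plateau_sub_bump (a : ℝ) (hα : LipschitzWith K α) (hβ : LipschitzWith K β)
    (hF : LipschitzWith K F) (hαβ : ∀ x, 0 ≤ α x + β x) :
    LipschitzWith K fun x => plateau a (α x) (β x) (F x) - bump (α x) (β x) := by
  simpa only [plateau_sub_bump _ _ (hαβ _)] using lipschitzWith_truncate_min_abs a hβ hα hF

end Truncation

section Perturbation

theorem exists_add_eq_of_forall_le_add {κ κ' : Type*} {P : κ → ℝ} {Q : κ' → ℝ} {D : ℝ}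
    (hD : 0 ≤ D) (hP : ∀ k, 0 ≤ P k) (hQ : ∀ l, 0 ≤ Q l) (hPQ : ∀ k l, D ≤ P k + Q l) :
    ∃ r s : ℝ, 0 ≤ r ∧ 0 ≤ s ∧ r + s = D ∧ (∀ k, r ≤ P k) ∧ ∀ l, s ≤ Q l := by
  obtain ⟨r, hr, hr'⟩ := exists_between_of_forall_le
    (s := insert 0 (Set.range fun l => D - Q l)) (t := insert D (Set.range P))
    (Set.insert_nonempty _ _) (Set.insert_nonempty _ _) (by
      simp only [Set.forall_mem_insert, Set.forall_mem_range]
      exact ⟨⟨hD, hP⟩, fun l => ⟨sub_le_self D (hQ l), fun k => sub_le_iff_le_add.2 (hPQ k l)⟩⟩)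
  simp only [upperBounds_insert, lowerBounds_insert, Set.mem_inter_iff, Set.mem_Ici, Set.mem_Iic,
    mem_upperBounds, mem_lowerBounds, Set.forall_mem_range] at hr hr'
  exact ⟨r, D - r, hr.1, sub_nonneg.2 hr'.1, add_sub_cancel r D, hr'.2,
    fun l => sub_le_comm.1 (hr.2 l)⟩

theorem exists_forall_abs_sub_le {κ : Type*} {F m : κ → ℝ}
    (h : ∀ x y, F x - F y ≤ m x + m y) : ∃ a, ∀ x, |F x - a| ≤ m x := by
  rcases isEmpty_or_nonempty κ with _ | _
  · exact ⟨0, isEmptyElim⟩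
  obtain ⟨a, ha, ha'⟩ := exists_between_of_forall_le (Set.range_nonempty fun x => F x - m x)
    (Set.range_nonempty fun x => F x + m x) (by
      simp only [Set.forall_mem_range]
      exact fun x y => by linarith [h x y])
  refine ⟨a, fun x => abs_le.2 ?_⟩
  constructor <;> linarith [ha (Set.mem_range_self x), ha' (Set.mem_range_self x)]

theorem exists_radii_centres {M ι : Type*} [PseudoMetricSpace M] {F : ι → M → ℝ} {A : Set M}
    {u v : M} {D : ℝ} (hD : 0 ≤ D) (hF : ∀ i, LipschitzWith 1 (F i))
    (htwo : ∀ x ∉ A, ∀ y ∉ A, ∀ i, |F i x - F i y| + D ≤ dist x u + dist y v)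
    (hfour : ∀ x ∉ A, ∀ y ∉ A, ∀ z ∉ A, ∀ w ∉ A, ∀ i j,
      F i x - F i y + (F j z - F j w) + 2 * D ≤ dist x u + dist y u + dist z v + dist w v) :
    ∃ r s : ℝ, 0 ≤ r ∧ 0 ≤ s ∧ r + s = D ∧
      ∀ i, ∃ a, ∀ x ∉ A, |F i x - a| ≤ min (dist x u - r) (dist x v - s) := by
  have hFp : ∀ i x y p, F i x - F i y ≤ dist x p + dist y p := fun i x y p =>
    (le_abs_self _).trans <| ((hF i).dist_le_mul x y).trans <| by
      simpa using dist_triangle_right x y p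
  obtain ⟨r, s, hr, hs, hrs, hru, hsv⟩ := exists_add_eq_of_forall_le_add hD
    (P := fun k : ι × ↥Aᶜ × ↥Aᶜ =>
      (dist k.2.1.1 u + dist k.2.2.1 u - (F k.1 k.2.1 - F k.1 k.2.2)) / 2)
    (Q := fun k : ι × ↥Aᶜ × ↥Aᶜ =>
      (dist k.2.1.1 v + dist k.2.2.1 v - (F k.1 k.2.1 - F k.1 k.2.2)) / 2)
    (fun ⟨i, x, y⟩ => by linarith [hFp i x y u]) (fun ⟨i, x, y⟩ => by linarith [hFp i x y v])
    (fun ⟨i, x, y⟩ ⟨j, z, w⟩ => by linarith [hfour x x.2 y y.2 z z.2 w w.2 i j])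
  refine ⟨r, s, hr, hs, hrs, fun i => ?_⟩
  obtain ⟨a, ha⟩ := exists_forall_abs_sub_le (F := fun x : ↥Aᶜ => F i x)
    (m := fun x => min (dist x.1 u - r) (dist x.1 v - s)) fun x y => by
      have hxy := abs_le.1 (le_sub_iff_add_le.2 (htwo x x.2 y y.2 i))
      have hyx := abs_le.1 (le_sub_iff_add_le.2 (htwo y y.2 x x.2 i))
      rw [← min_add_add_right, ← min_add_add_left, ← min_add_add_left]
      refine le_min (le_min ?_ ?_) (le_min ?_ ?_)
      · linarith [hru (i, x, y)]
      · linarith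
      · linarith
      · linarith [hsv (i, x, y)]
  exact ⟨a, fun x hx => ha ⟨x, hx⟩⟩

theorem exists_common_perturbation {M ι : Type*} [PseudoMetricSpace M] {F : ι → M → ℝ} {A : Set M}
    {u v : M} {D : ℝ} (hD : 0 ≤ D) (hDuv : D ≤ dist u v) (hF : ∀ i, LipschitzWith 1 (F i))
    (htwo : ∀ x ∉ A, ∀ y ∉ A, ∀ i, |F i x - F i y| + D ≤ dist x u + dist y v)
    (hfour : ∀ x ∉ A, ∀ y ∉ A, ∀ z ∉ A, ∀ w ∉ A, ∀ i j,
      F i x - F i y + (F j z - F j w) + 2 * D ≤ dist x u + dist y u + dist z v + dist w v) :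
    ∃ (g : M → ℝ) (h : ι → M → ℝ), LipschitzWith 1 g ∧
      (∀ i, (LipschitzWith 1 fun x => h i x + g x) ∧ LipschitzWith 1 fun x => h i x - g x) ∧
      (∀ i, ∀ x ∉ A, g x = 0 ∧ h i x = F i x) ∧ g u - g v = D := by
  obtain ⟨r, s, hr, hs, hrs, hcentre⟩ := exists_radii_centres hD hF htwo hfour
  choose a ha using hcentre
  have hα : LipschitzWith 1 fun x => dist x u - r := by
    simpa using (LipschitzWith.dist_left u).sub (.const r)
  have hβ : LipschitzWith 1 fun x => dist x v - s := by
    simpa using (LipschitzWith.dist_left v).sub (.const s)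
  have hαβ : ∀ x, 0 ≤ dist x u - r + (dist x v - s) := fun x => by
    linarith [dist_triangle_left u v x]
  refine ⟨fun x => bump (dist x u - r) (dist x v - s),
    fun i x => plateau (a i) (dist x u - r) (dist x v - s) (F i x), lipschitzWith_bump hα hβ,
    fun i => ⟨lipschitzWith_plateau_add_bump (a i) hα hβ (hF i) hαβ,
      lipschitzWith_plateau_sub_bump (a i) hα hβ (hF i) hαβ⟩, fun i x hx => ?_, ?_⟩
  · obtain ⟨hu, hv⟩ := le_min_iff.1 (ha i x hx)
    exact ⟨bump_eq_zero ((abs_nonneg _).trans hu) ((abs_nonneg _).trans hv), plateau_eq_self hu hv⟩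
  · have hgu : bump (dist u u - r) (dist u v - s) = r := by
      rw [bump, truncate, dist_self, min_eq_left (by linarith)]
      exact (max_eq_left (by linarith)).trans (by ring)
    have hgv : bump (dist v u - r) (dist v v - s) = -s := by
      rw [bump, truncate, dist_self, dist_comm v u, min_eq_right (by linarith)]
      exact (max_eq_right (by linarith)).trans (by ring)
    simp only [hgu, hgv, sub_neg_eq_add, hrs]

end Perturbation

section SymmetricStrongDiameterTwo

variable {X : Type*} [NormedAddCommGroup X] [NormedSpace ℝ X]

theorem norm_le_of_norm_add_le_of_norm_sub_le {f g : X} {C : ℝ} (hadd : ‖f + g‖ ≤ C)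
    (hsub : ‖f - g‖ ≤ C) : ‖f‖ ≤ C := by
  have hf : (2 : ℝ) • f = (f + g) + (f - g) := by module
  have htri := norm_add_le (f + g) (f - g)
  rw [← hf, norm_smul, Real.norm_two] at htri
  linarith

theorem exists_lt_apply_of_norm_eq_one {φ : StrongDual ℝ X} (hφ : ‖φ‖ = 1) {α : ℝ} (hα : 0 < α) :
    ∃ f : X, ‖f‖ ≤ 1 ∧ 1 - α < φ f := by
  obtain ⟨f, hf, h⟩ := φ.exists_lt_apply_of_lt_opNorm (r := 1 - α) (by linarith)
  rcases lt_abs.1 h with h | h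
  · exact ⟨f, hf.le, h⟩
  · exact ⟨-f, (norm_neg f).trans_le hf.le, by rwa [map_neg]⟩

theorem ssd2p_of_forall_exists_perturbation
    (hX : ∀ (n : ℕ) (φ : Fin n → StrongDual ℝ X) (f : Fin n → X), (∀ i, ‖φ i‖ = 1) →
      (∀ i, ‖f i‖ ≤ 1) → ∀ ε > 0, ∃ (g : X) (h : Fin n → X), ‖g‖ ≤ 1 ∧ 1 - ε < ‖g‖ ∧
        (∀ i, ‖h i + g‖ ≤ 1 ∧ ‖h i - g‖ ≤ 1) ∧
        ∀ i, |φ i g| < ε ∧ |φ i (h i - f i)| < ε) : SSD2P X := by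
  intro n S hS ε hε
  choose φ hφ α hα hSφ using hS
  choose f hf hfα using fun i => exists_lt_apply_of_norm_eq_one (hφ i) (hα i)
  obtain ⟨δ, hδ, hδα⟩ := Pi.exists_forall_pos_add_lt hfα
  obtain ⟨g, h, hg, hgε, hhg, hφε⟩ := hX n φ f hφ hf (min ε (δ / 2)) (lt_min hε (half_pos hδ))
  have hφg : ∀ i, |φ i g| < δ / 2 := fun i => (hφε i).1.trans_le (min_le_right _ _)
  have hφh : ∀ i, φ i (f i) - δ / 2 < φ i (h i) := fun i => by
    have := (abs_lt.1 ((hφε i).2.trans_le (min_le_right _ _))).1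
    rw [map_sub] at this
    linarith
  simp only [hSφ, Set.mem_ofPred_eq, map_add, map_sub]
  refine ⟨h, g, fun i => ⟨norm_le_of_norm_add_le_of_norm_sub_le (hhg i).1 (hhg i).2, ?_⟩, hg,
    (sub_le_sub_left (min_le_left _ _) 1).trans_lt hgε,
    fun i => ⟨⟨(hhg i).1, ?_⟩, (hhg i).2, ?_⟩⟩
  all_goals linarith [hφh i, hδα i, abs_lt.1 (hφg i)]

end SymmetricStrongDiameterTwo

namespace FSLTP

variable {M : Type*} [MetricSpace M] {o : M}
  {μ : AddContent ℝ (Set.univ : Set (Set (OffDiagPair M)))} {ε : ℝ} {n : ℕ}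
  {f : Fin n → LipZero o}

theorem exists_gammaSet_lt (hM : FSLTP o) (hμ : μ ∈ ba (OffDiagPair M)) (hμ0 : ∀ S, 0 ≤ μ S)
    (hε : 0 < ε) (hε1 : ε < 1) (hf : ∀ i, ‖f i‖ ≤ 1) :
    ∃ (A : Set M) (u v : M), μ (gammaSet A) < ε ∧ u ≠ v ∧
      (∀ x ∉ A, ∀ y ∉ A, ∀ i, (1 - ε) * (|f i x - f i y| + dist u v) ≤ dist x u + dist y v) ∧
      ∀ x ∉ A, ∀ y ∉ A, ∀ z ∉ A, ∀ w ∉ A, ∀ i j,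
        (1 - ε) * (f i x - f i y + (f j z - f j w) + 2 * dist u v) ≤
          dist x u + dist y u + dist z v + dist w v := by
  have hf_neg : ∀ k, ‖Fin.append f (-f) k‖ ≤ 1 := Fin.addCases
    (fun i => by simpa only [Fin.append_left] using hf i)
    (fun i => by simpa only [Fin.append_right, Pi.neg_apply, norm_neg] using hf i)
  obtain ⟨A, u, v, hA, -, -, huv, htwo, hfour⟩ := hM μ hμ hμ0 ε hε hε1 _ _ hf_neg
  refine ⟨A, u, v, hA, huv, fun x hx y hy i => ?_, fun x hx y hy z hz w hw i j => ?_⟩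
  · have hpos := htwo x hx y hy (Fin.castAdd n i)
    have hneg := htwo x hx y hy (Fin.natAdd n i)
    simp only [Fin.append_left, Fin.append_right, Pi.neg_apply, LipZero.neg_apply] at hpos hneg
    rcases abs_cases (f i x - f i y) with ⟨h, -⟩ | ⟨h, -⟩ <;> rw [h] <;> linarith
  · simpa only [Fin.append_left] using
      hfour x hx y hy z hz w hw (Fin.castAdd n i) (Fin.castAdd n j)

theorem exists_perturbation (hM : FSLTP o) (hμ : μ ∈ ba (OffDiagPair M)) (hμ0 : ∀ S, 0 ≤ μ S)
    (hε : 0 < ε) (hε1 : ε < 1) (hf : ∀ i, ‖f i‖ ≤ 1) :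
    ∃ (A : Set M) (g : LipZero o) (h : Fin n → LipZero o), μ (gammaSet A) < ε ∧
      ‖g‖ ≤ 1 ∧ 1 - ε ≤ ‖g‖ ∧ (∀ i, ‖h i + g‖ ≤ 1 ∧ ‖h i - g‖ ≤ 1) ∧
      ∀ i, ∀ x ∉ A, ∀ y ∉ A, g x = g y ∧ (h i - (1 - ε) • f i) x = (h i - (1 - ε) • f i) y := by
  obtain ⟨A, u, v, hA, huv, htwo, hfour⟩ := hM.exists_gammaSet_lt hμ hμ0 hε hε1 hf
  have hε0 : 0 ≤ 1 - ε := by linarith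
  have hF : ∀ i, ‖(1 - ε) • f i‖ ≤ 1 := fun i => by
    rw [norm_smul, Real.norm_of_nonneg hε0]
    exact mul_le_one₀ (by linarith) (norm_nonneg _) (hf i)
  obtain ⟨G, H, hG, hHG, hoff, hGuv⟩ := exists_common_perturbation (D := (1 - ε) * dist u v)
    (mul_nonneg hε0 dist_nonneg) (mul_le_of_le_one_left dist_nonneg (by linarith))
    (fun i => LipZero.lipschitzWith_one (hF i))
    (fun x hx y hy i => by
      simpa only [LipZero.smul_apply, ← mul_sub, abs_mul, abs_of_nonneg hε0, mul_add] using
        htwo x hx y hy i)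
    (fun x hx y hy z hz w hw i j => by
      have := hfour x hx y hy z hz w hw i j
      simp only [LipZero.smul_apply]
      linarith)
  have hH : ∀ i, LipschitzWith (1 + 1) (H i) := fun i => by
    simpa only [add_sub_cancel_right] using (hHG i).1.sub hG
  refine ⟨A, .ofLipschitzWith o hG, fun i => .ofLipschitzWith o (hH i), hA,
    LipZero.norm_le_of_lipschitzWith hG fun x y => ?_, ?_,
    fun i => ⟨LipZero.norm_le_of_lipschitzWith (hHG i).1 fun x y => ?_,
      LipZero.norm_le_of_lipschitzWith (hHG i).2 fun x y => ?_⟩,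
    fun i x hx y hy => ⟨?_, ?_⟩⟩
  · simp only [LipZero.ofLipschitzWith_apply, sub_sub_sub_cancel_right]
  · refine le_of_mul_le_mul_right ?_ (dist_pos.2 huv)
    rw [← hGuv, ← sub_sub_sub_cancel_right (G u) (G v) (G o)]
    exact (le_abs_self _).trans (LipZero.abs_sub_le_norm_mul (.ofLipschitzWith o hG) u v)
  · simp only [LipZero.add_apply, LipZero.ofLipschitzWith_apply]
    ring
  · simp only [LipZero.sub_apply, LipZero.ofLipschitzWith_apply]
    ring
  · simp only [LipZero.ofLipschitzWith_apply, hoff i x hx, hoff i y hy]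
  · simp only [LipZero.sub_apply, LipZero.ofLipschitzWith_apply, hoff i x hx, hoff i y hy]
    ring

theorem ssd2p (hM : FSLTP o) : SSD2P (LipZero o) := by
  refine ssd2p_of_forall_exists_perturbation fun n φ f hφ hf ε hε => ?_
  obtain ⟨δ, hδ, hδmin⟩ := exists_between (lt_min (show 0 < ε / 3 by positivity) one_pos)
  obtain ⟨hδε, hδ1⟩ := lt_min_iff.1 hδmin
  obtain ⟨μ, hμ, hμ0, hφμ⟩ := LipZero.exists_mem_ba_forall_abs_apply_le_gammaSet φ
  obtain ⟨A, g, h, hA, hg, hgδ, hhg, hoff⟩ := hM.exists_perturbation hμ hμ0 hδ hδ1 hf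
  have hφA : ∀ i (k : LipZero o), (∀ x ∉ A, ∀ y ∉ A, k x = k y) → |φ i k| ≤ ‖k‖ * δ :=
    fun i k hk => (hφμ i A k hk).trans (mul_le_mul_of_nonneg_left hA.le (norm_nonneg k))
  refine ⟨g, h, hg, by linarith, hhg, fun i => ⟨?_, ?_⟩⟩
  · nlinarith [hφA i g fun x hx y hy => (hoff i x hx y hy).1]
  · have hh : ‖h i‖ ≤ 1 := norm_le_of_norm_add_le_of_norm_sub_le (hhg i).1 (hhg i).2
    have hφf : |φ i (f i)| ≤ 1 := by simpa [hφ i] using (φ i).le_of_opNorm_le_of_le le_rfl (hf i)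
    have hnorm : ‖h i - (1 - δ) • f i‖ ≤ 2 := by
      refine (norm_sub_le _ _).trans ?_
      rw [norm_smul, Real.norm_of_nonneg (by linarith)]
      nlinarith [hf i, norm_nonneg (f i)]
    have hφh := hφA i (h i - (1 - δ) • f i) fun x hx y hy => (hoff i x hx y hy).2
    calc |φ i (h i - f i)| = |φ i (h i - (1 - δ) • f i) - δ * φ i (f i)| := by
          simp only [map_sub, map_smul, smul_eq_mul]
          ring_nf
      _ ≤ |φ i (h i - (1 - δ) • f i)| + δ * |φ i (f i)| := by
          simpa only [abs_mul, abs_of_pos hδ] using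
            abs_sub (φ i (h i - (1 - δ) • f i)) (δ * φ i (f i))
      _ ≤ 2 * δ + δ * 1 := by gcongr; exact hφh.trans (by gcongr)
      _ < ε := by linarith

end FSLTP

section Example

open Function

theorem fsltp_of_forall_exists_dist_eq {M : Type*} [MetricSpace M] {D : ℝ}
    (hD : ∀ x y : M, dist x y ≤ D)
    (hM : ∀ μ : AddContent ℝ (Set.univ : Set (Set (OffDiagPair M))), (∀ S, 0 ≤ μ S) → ∀ ε > 0,
      ∃ (A : Set M) (u v : M), μ (gammaSet A) < ε ∧ u ∈ A ∧ v ∈ A ∧ u ≠ v ∧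
        ∀ x ∉ A, dist x u = D ∧ dist x v = D) (o : M) : FSLTP o := by
  intro μ _ hμ ε hε hε1 n f hf
  obtain ⟨A, u, v, hA, hu, hv, huv, hfar⟩ := hM μ hμ ε hε
  have hfD : ∀ i x y, f i x - f i y ≤ D := fun i x y =>
    (LipZero.sub_le_dist (hf i) x y).trans (hD x y)
  have hD0 : 0 ≤ D := dist_nonneg.trans (hD u v)
  refine ⟨A, u, v, hA, hu, hv, huv, fun x hx y hy i => ?_, fun x hx y hy z hz w hw i j => ?_⟩
  · rw [(hfar x hx).1, (hfar y hy).2]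
    nlinarith [hfD i x y, hD u v]
  · rw [(hfar x hx).1, (hfar y hy).1, (hfar z hz).2, (hfar w hw).2]
    nlinarith [hfD i x y, hfD j z w, hD u v]

theorem exists_forall_mem_of_dist_eq_one {M : Type*} [MetricSpace M]
    (hM : ∀ x y : M, x ≠ y → 1 ≤ dist x y) {A : Set M} {u v : M} (hu : u ∈ A) (hv : v ∈ A)
    (huv : u ≠ v) {ε : ℝ} (hε : ε < 1 / 3) (h : ∀ x ∉ A, ∀ y ∉ A,
      (1 - ε) * (dist x y + dist u v) ≤ dist x u + dist y v) :
    ∃ p ∈ A, ∃ x, x ≠ p ∧ ∀ c, dist c p = 1 → dist c x = 2 → c ∈ A := by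
  by_cases hsphere : ∀ c, dist c u = 1 → c ∈ A
  · exact ⟨u, hu, v, huv.symm, fun c hcu _ => hsphere c hcu⟩
  push Not at hsphere
  obtain ⟨x, hxu, hx⟩ := hsphere
  refine ⟨v, hv, x, fun hxv => hx (hxv ▸ hv), fun c hcv hcx => ?_⟩
  by_contra hc
  have := h x hx c hc
  rw [hxu, hcv, dist_comm x c, hcx] at this
  nlinarith [hM u v huv]

theorem exists_ne_and_ne_of_injective {ι X : Type*} [Infinite ι] {p : ι → X} (hp : Injective p)
    (x : ι → X) : ∃ i j, i ≠ j ∧ x i ≠ p j ∧ x j ≠ p i := by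
  by_contra! h
  obtain ⟨k⟩ : Nonempty ι := inferInstance
  have hfin : (insert k (p ⁻¹' {x k})).Finite :=
    ((Set.finite_singleton (x k)).preimage hp.injOn).insert k
  have hxk : ∀ i ∉ insert k (p ⁻¹' {x k}), x i = p k ∧ i ≠ k := by
    intro i hi
    obtain ⟨hik, hpi⟩ : i ≠ k ∧ p i ≠ x k := by simpa using hi
    exact ⟨h k i hik.symm hpi.symm, hik⟩
  obtain ⟨i, hi, j, hj, hij⟩ := hfin.infinite_compl.nontrivial
  obtain ⟨⟨hxi, hik⟩, hxj, hjk⟩ := And.intro (hxk i hi) (hxk j hj)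
  exact hik (hp ((h i j hij fun hxij => hjk (hp (hxij ▸ hxi).symm).symm).symm.trans hxj))

theorem not_seqSLTP_of_exists_dist_eq {M : Type*} [MetricSpace M]
    (hM : ∀ x y : M, x ≠ y → 1 ≤ dist x y)
    (hext : ∀ p q x y : M, x ≠ p → x ≠ q → y ≠ p → y ≠ q →
      ∃ c, dist c p = 1 ∧ dist c q = 1 ∧ dist c x = 2 ∧ dist c y = 2) : ¬ SeqSLTP M := by
  intro h
  obtain ⟨A, u, v, hdisj, hA⟩ := h (1 / 4) (by norm_num)
  choose p hp x hxp hc using fun m =>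
    exists_forall_mem_of_dist_eq_one hM (hA m).1 (hA m).2.1 (hA m).2.2.1
      (by norm_num) (hA m).2.2.2.1
  have hp_inj : Injective p := fun m n hmn => by
    by_contra hne
    exact Set.disjoint_left.1 (hdisj m n hne) (hp m) (hmn ▸ hp n)
  obtain ⟨m, n, hmn, hxm, hxn⟩ := exists_ne_and_ne_of_injective hp_inj x
  -- A common neighbour of `p m` and `p n` far from `x m` and `x n` lies in both `A m` and `A n`.
  obtain ⟨c, hcm, hcn, hcxm, hcxn⟩ := hext (p m) (p n) (x m) (x n) (hxp m) hxm hxn (hxp n)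
  exact Set.disjoint_left.1 (hdisj m n hmn) (hc m c hcm hcxm) (hc n c hcn hcxn)

open Classical in
/-- The metric on the vertex set of a graph in which adjacent vertices have distance `1` and other
distinct vertices have distance `2`. -/
noncomputable abbrev oneTwoMetricSpace {V : Type*} (G : SimpleGraph V) : MetricSpace V where
  dist x y := if x = y then 0 else if G.Adj x y then 1 else 2
  dist_self x := if_pos rfl
  dist_comm x y := by simp only [G.adj_comm x y, eq_comm (a := x)]
  dist_triangle x y z := by
    by_cases hxy : x = y
    · simp [hxy]
    by_cases hyz : y = z
    · simp [hyz]
    simp only [hxy, hyz, if_false]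
    split_ifs <;> norm_num
  eq_of_dist_eq_zero {x y} h := by
    by_contra hxy
    simp only [hxy, if_false] at h
    split_ifs at h <;> norm_num at h

/-- Vertices generated freely from countably many base points: any two vertices `a`, `b` have
countably many children `node a b k`. -/
inductive FreeVertex : Type
  | base (n : ℕ)
  | node (a b : FreeVertex) (k : ℕ)

namespace FreeVertex

/-- The first parent of a vertex; a base point is its own parent. -/
def left : FreeVertex → FreeVertex
  | base n => base n
  | node a _ _ => a

/-- The second parent of a vertex; a base point is its own parent. -/
def right : FreeVertex → FreeVertex
  | base n => base n
  | node _ b _ => b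

/-- The graph joining every vertex to its parents. -/
def graph : SimpleGraph FreeVertex := .fromRel fun x y => x = y.left ∨ x = y.right

theorem exists_adj_adj_not_adj_not_adj {p q x y : FreeVertex} (hxp : x ≠ p) (hxq : x ≠ q)
    (hyp : y ≠ p) (hyq : y ≠ q) :
    ∃ c, graph.Adj c p ∧ graph.Adj c q ∧ (c ≠ x ∧ ¬ graph.Adj c x) ∧ c ≠ y ∧ ¬ graph.Adj c y := by
  have hnode : Injective (node p q) := fun k l h => (node.inj h).2.2
  obtain ⟨_, ⟨k, rfl⟩, hc⟩ := (Set.infinite_range_of_injective hnode).exists_notMem_finite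
    (Set.toFinite {p, q, x, x.left, x.right, y, y.left, y.right})
  simp only [Set.mem_insert_iff, Set.mem_singleton_iff, not_or] at hc
  refine ⟨node p q k, ?_⟩
  simp only [graph, SimpleGraph.fromRel_adj, left, right]
  tauto

noncomputable instance : MetricSpace FreeVertex := oneTwoMetricSpace graph

theorem dist_eq_one {x y : FreeVertex} (h : graph.Adj x y) : dist x y = 1 :=
  (if_neg h.ne).trans (if_pos h)

theorem dist_eq_two {x y : FreeVertex} (hne : x ≠ y) (h : ¬ graph.Adj x y) : dist x y = 2 :=
  (if_neg hne).trans (if_neg h)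

theorem dist_le_two (x y : FreeVertex) : dist x y ≤ 2 := by
  simp only [dist]
  split_ifs <;> norm_num

theorem one_le_dist {x y : FreeVertex} (hne : x ≠ y) : 1 ≤ dist x y := by
  by_cases h : graph.Adj x y
  · exact (dist_eq_one h).ge
  · exact one_le_two.trans (dist_eq_two hne h).ge

theorem dist_base_eq_two {x : FreeVertex} {n : ℕ} (hl : x.left ≠ base n)
    (hr : x.right ≠ base n) : dist x (base n) = 2 := by
  have hne : x ≠ base n := by rintro rfl; exact hl rfl
  refine dist_eq_two hne fun h => ?_
  simp only [graph, SimpleGraph.fromRel_adj, left, right] at h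
  tauto

theorem fsltp (o : FreeVertex) : FSLTP o := by
  refine fsltp_of_forall_exists_dist_eq dist_le_two (fun μ hμ ε hε => ?_) o
  let P : ℕ → Set FreeVertex := fun k => {base (2 * k), base (2 * k + 1)}
  have hP : Pairwise (Disjoint on P) := fun k l hkl => Set.disjoint_left.2 <| by
    simp only [P, Set.mem_insert_iff, Set.mem_singleton_iff]
    rintro _ (rfl | rfl) <;> simp only [base.injEq] <;> omega
  have hleft : Pairwise (Disjoint on fun k => left ⁻¹' P k) := fun _ _ h => (hP h).preimage _
  have hright : Pairwise (Disjoint on fun k => right ⁻¹' P k) := fun _ _ h => (hP h).preimage _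
  obtain ⟨k, hk⟩ := ((tendsto_addContent_gammaSet_union hμ hleft
    hright).eventually_lt_const hε).exists
  refine ⟨_, base (2 * k), base (2 * k + 1), hk, .inl (.inl rfl), .inl (.inr rfl), by simp,
    fun x hx => ?_⟩
  simp only [P, Set.mem_union, Set.mem_preimage, Set.mem_insert_iff, Set.mem_singleton_iff,
    not_or] at hx
  obtain ⟨⟨hl₀, hl₁⟩, hr₀, hr₁⟩ := hx
  exact ⟨dist_base_eq_two hl₀ hr₀, dist_base_eq_two hl₁ hr₁⟩

theorem not_seqSLTP : ¬ SeqSLTP FreeVertex := by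
  refine not_seqSLTP_of_exists_dist_eq (fun _ _ => one_le_dist)
    fun p q x y hxp hxq hyp hyq => ?_
  obtain ⟨c, hcp, hcq, ⟨hne_x, hcx⟩, hne_y, hcy⟩ :=
    exists_adj_adj_not_adj_not_adj hxp hxq hyp hyq
  exact ⟨c, dist_eq_one hcp, dist_eq_one hcq,
    dist_eq_two hne_x hcx, dist_eq_two hne_y hcy⟩

end FreeVertex

end Example

theorem mainTheorem3 :
    (∀ (M : Type u) [MetricSpace M] (o : M), FSLTP o → SSD2P (LipZero o)) ∧
      (∀ (M : Type u) [MetricSpace M] (o : M), SeqSLTP M → FSLTP o) ∧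
      ∃ (M : Type) (_ : MetricSpace M) (o : M), FSLTP o ∧ ¬ SeqSLTP M :=
  ⟨fun _ _ _ h => h.ssd2p, fun _ _ o h => h.fsltp o,
    FreeVertex, inferInstance, .base 0, FreeVertex.fsltp _, FreeVertex.not_seqSLTP⟩
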